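/- Let $k$ be a field of characteristic zero, $R$ a commutative unital $k$-algebra and $s\in\mathbb N$. A formal power series $f=\sum_w f_w x_w$ in the non-commuting variables $x_1,\dots,x_s$ over $R$ is identified with the linear functional $x_w\mapsto f_w$ on $R\langle x_1,\dots,x_s\rangle$; the words $w=(i_1\dots i_n)$ have letters in $\{1,\dots,s\}$ and length $|w|=n$. Let $\Delta_m:R\langle x_1,\dots,x_s\rangle\to R\langle x_1,\dots,x_s,y_1,\dots,y_s\rangle$ be the unital algebra morphism with $\Delta_m(x_i)=x_iy_i$. Let $f,g$ be power series with constant term $1$. Write a word in the letters $x_i,y_i$ as $u=v_1v_2\cdots v_m$, where the $v_j$ are alternately non-empty words in the $x$-letters ($\epsilon_j=1$) and non-empty words in the $y$-letters ($\epsilon_j=2$), and put $\varphi_1=f$, $\varphi_2=g$ (a $y$-word being evaluated under $g$ as the corresponding $x$-word). The free, boolean, monotone and anti-monotone products of $f$ and $g$ are the linear functionals on $R\langle x_1,\dots,x_s,y_1,\dots,y_s\rangle$ with value $1$ on the empty word and, on $u$ as above with $m\ge 1$, $$(f\bullet_{F}g)(u)=\sum_{I\subsetneq\{1,\dots,m\}}(-1)^{m-|I|+1}(f\bullet_{F}g)\Big(\prod_{j\in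 I}v_j\Big)\prod_{j\notin I}\varphi_{\epsilon_j}(v_j)\quad\text{(recursively)},$$ $$(f\bullet_{B}g)(u)=\prod_{\epsilon_j=1}f(v_j)\prod_{\epsilon_j=2}g(v_j),\qquad (f\bullet_{M}g)(u)=f\Big(\prod_{\epsilon_j=1}v_j\Big)\prod_{\epsilon_j=2}g(v_j),\qquad (f\bullet_{aM}g)(u)=\prod_{\epsilon_j=1}f(v_j)\;g\Big(\prod_{\epsilon_j=2}v_j\Big),$$ where products of the $v_j$ are concatenations in increasing order of $j$. The multiplicative convolutions are $f\boxtimes_V g=(f\bullet_{F}g)\circ\Delta_m$ and $f\star_{\bullet,m}g=(f\bullet g)\circ\Delta_m$ for $\bullet\in\{B,M,aM\}$. **Theorem.** Let $w$ be a word with $|w|\ge 2$. There is a polynomial $P_w$ with integer coefficients in commuting variables $X_u,Y_v$ indexed by words $u,v$, depending only on $s$ and $w$ (not on $k,R,f,g$), such that for all $k$, $R$ as above and all power series $f,g$ over $R$ with constant term $1$ $$(f\boxtimes_V g)_w=(f\star_{M,m}g)_w+(f\star_{aM,m}g)_w+(-1)^{|w|-1}C_{|w|-1}\,(f\star_{B,m}g)_w+P_w(f,g),$$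 where $C_n=\frac1{n+1}\binom{2n}{n}$ is the $n$-th Catalan number and $P_w(f,g)$ is $P_w$ evaluated at $X_u=f_u$, $Y_v=g_v$. Here $P_w$ consists of mixed terms only: giving $X_u$ and $Y_u$ the degree $|u|$, it is homogeneous of degree $|w|$ in the $X$-variables and homogeneous of degree $|w|$ in the $Y$-variables; all variables $X_u,Y_u$ that occur in it satisfy $1\le|u|<|w|$; and each of its monomials contains some $X_u$ with $2\le|u|<|w|$ or some $Y_v$ with $2\le|v|<|w|$. -/

import Mathlib

noncomputable section

namespace MomentConvolution

/-- Formal power series in the non-commuting variables `x_1, …, x_s` with coefficients in `R`: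
the family of coefficients, indexed by all words (including the empty word `1`). -/
abbrev NCSeries (R : Type*) (s : ℕ) : Type _ := FreeMonoid (Fin s) → R

/-- Letters of the polynomial algebra `R⟨x_1, …, x_s, y_1, …, y_s⟩`, which is the coproduct of two
copies of `R⟨x_1, …, x_s⟩` in unital algebras: `Sum.inl i` is `x_i` and `Sum.inr i` is `y_i`. -/
abbrev Letter (s : ℕ) : Type := Fin s ⊕ Fin s

/-- The word in `x` obtained from `u` by deleting all `y`-letters. -/
def xPart {s : ℕ} (u : List (Letter s)) : FreeMonoid (Fin s) :=
  FreeMonoid.ofList (u.filterMap Sum.getLeft?)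

/-- The word in `y` obtained from `u` by deleting all `x`-letters. -/
def yPart {s : ℕ} (u : List (Letter s)) : FreeMonoid (Fin s) :=
  FreeMonoid.ofList (u.filterMap Sum.getRight?)

/-- The decomposition `u = v_1 v_2 ⋯ v_m` of a word into maximal blocks, each a non-empty word
in the `x`-letters only or in the `y`-letters only, alternating between the two kinds. -/
def blocks {s : ℕ} (u : List (Letter s)) : List (List (Letter s)) :=
  u.splitBy (fun a b => a.isLeft == b.isLeft)

/-- The `x`-blocks of `u`, in order. -/
def xBlocks {s : ℕ} (u : List (Letter s)) : List (FreeMonoid (Fin s)) :=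
  ((blocks u).map xPart).filter (fun v => 0 < v.length)

/-- The `y`-blocks of `u`, in order. -/
def yBlocks {s : ℕ} (u : List (Letter s)) : List (FreeMonoid (Fin s)) :=
  ((blocks u).map yPart).filter (fun v => 0 < v.length)

/-- The concatenation, in order, of those `v i` with `i ∈ I`. -/
def concatOn {α : Type*} (v : List (List α)) (I : Finset (Fin v.length)) : List α :=
  ((List.finRange v.length).filter (fun i => i ∈ I)).flatMap v.get

theorem length_concatOn {α : Type*} (v : List (List α)) (I : Finset (Fin v.length)) :
    (concatOn v I).length = ∑ i ∈ I, (v.get i).length := by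
  have h : ((List.finRange v.length).filter (fun i => i ∈ I)).toFinset = I := by
    ext i; simp
  have hn : ((List.finRange v.length).filter (fun i => i ∈ I)).Nodup :=
    (List.nodup_finRange _).filter _
  conv_rhs => rw [← h]
  rw [concatOn, List.length_flatMap, List.sum_toFinset _ hn]

theorem length_concatOn_blocks_lt {s : ℕ} (u : List (Letter s))
    (I : Finset (Fin (blocks u).length)) (hI : I ⊂ Finset.univ) :
    (concatOn (blocks u) I).length < u.length := by
  have hu : u.length = ∑ i, ((blocks u).get i).length := by
    have h1 : (concatOn (blocks u) Finset.univ) = u := by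
      simp only [concatOn, Finset.mem_univ, decide_true, List.filter_true]
      rw [List.flatMap_def, List.map_get_finRange]
      exact List.flatten_splitBy _ _
    conv_lhs => rw [← h1]
    exact length_concatOn _ _
  rw [length_concatOn, hu]
  obtain ⟨j, -, hj⟩ := Finset.exists_of_ssubset hI
  refine Finset.sum_lt_sum_of_subset (Finset.subset_univ I) (Finset.mem_univ j) hj ?_
    (fun _ _ _ => Nat.zero_le _)
  rw [List.length_pos_iff]
  intro h0
  have hmem : (blocks u).get j ∈ blocks u := List.get_mem _ _
  rw [h0] at hmem
  exact List.nil_notMem_splitBy _ _ hmem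

section Products

variable {R : Type*} [CommRing R] {s : ℕ}

/-- The linear functional on non-commutative polynomials in the letters `X` with prescribed values
on the words. -/
def functional {X : Type*} (h : FreeMonoid X → R) : FreeAlgebra R X →ₗ[R] R :=
  (FreeAlgebra.basisFreeMonoid R X).constr R h

/-- The value `φ_ε(v)` of a block: that of `f` for an `x`-block, that of `g` for a `y`-block. -/
def blockValue (f g : NCSeries R s) (v : List (Letter s)) : R :=
  if (yPart v).length = 0 then f (xPart v) else g (yPart v)

/-- The free product of `f` and `g` on a word `u = v_1 ⋯ v_m` with alternating blocks `v_i`,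
by the recursion
`(f • g)(u) = ∑_{I ⊊ {1,…,m}} (-1)^(m - |I| + 1) (f • g)(∏_{i ∈ I} v_i) ∏_{i ∉ I} φ_{ε_i}(v_i)`,
with value `1` at the empty word. -/
def freeWord (f g : NCSeries R s) (u : List (Letter s)) : R :=
  if u = [] then 1
  else
    ∑ I ∈ ((Finset.univ : Finset (Fin (blocks u).length)).ssubsets).attach,
      (-1) ^ ((blocks u).length - I.1.card + 1)
        * freeWord f g (concatOn (blocks u) I.1)
        * ∏ i ∈ I.1ᶜ, blockValue f g ((blocks u).get i)
termination_by u.length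
decreasing_by exact length_concatOn_blocks_lt u I.1 (Finset.mem_ssubsets.1 I.2)

/-- The free product of two functionals (moment series), as a functional on `R⟨x, y⟩`. -/
def freeProd (f g : NCSeries R s) : FreeAlgebra R (Letter s) →ₗ[R] R :=
  functional (fun u => freeWord f g u.toList)

/-- The boolean product: `∏_{ε_i = 1} f(v_i) · ∏_{ε_i = 2} g(v_i)`. -/
def booleanProd (f g : NCSeries R s) : FreeAlgebra R (Letter s) →ₗ[R] R :=
  functional (fun u => ((xBlocks u.toList).map f).prod * ((yBlocks u.toList).map g).prod)

/-- The monotone product: `f(∏_{ε_i = 1} v_i) · ∏_{ε_i = 2} g(v_i)`. -/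
def monotoneProd (f g : NCSeries R s) : FreeAlgebra R (Letter s) →ₗ[R] R :=
  functional (fun u => f (xPart u.toList) * ((yBlocks u.toList).map g).prod)

/-- The anti-monotone product: `∏_{ε_i = 1} f(v_i) · g(∏_{ε_i = 2} v_i)`. -/
def antiMonotoneProd (f g : NCSeries R s) : FreeAlgebra R (Letter s) →ₗ[R] R :=
  functional (fun u => ((xBlocks u.toList).map f).prod * g (yPart u.toList))

variable (R s) in
/-- The multiplicative (group-like) coproduct `Δ_m`, the unital algebra morphism with
`Δ_m(x_i) = x_i y_i`. -/
def comulM : FreeAlgebra R (Fin s) →ₐ[R] FreeAlgebra R (Letter s) :=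
  FreeAlgebra.lift R (fun i => FreeAlgebra.ι R (Sum.inl i) * FreeAlgebra.ι R (Sum.inr i))

/-- The moment series whose coefficient at the word `w` is `Φ(Δ_m(x_w))`, that is, `Φ ∘ Δ_m`
regarded as a power series. -/
def convM (Φ : FreeAlgebra R (Letter s) →ₗ[R] R) : NCSeries R s :=
  fun w => Φ (comulM R s (FreeMonoid.lift (FreeAlgebra.ι R) w))

/-- Multiplicative free convolution `f ⊠_V g`. -/
def freeConvM (f g : NCSeries R s) : NCSeries R s := convM (freeProd f g)

/-- Multiplicative boolean convolution `f ⋆_{B,m} g`. -/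
def booleanConvM (f g : NCSeries R s) : NCSeries R s := convM (booleanProd f g)

/-- Multiplicative monotone convolution `f ⋆_{M,m} g`. -/
def monotoneConvM (f g : NCSeries R s) : NCSeries R s := convM (monotoneProd f g)

/-- Multiplicative anti-monotone convolution `f ⋆_{aM,m} g`. -/
def antiMonotoneConvM (f g : NCSeries R s) : NCSeries R s := convM (antiMonotoneProd f g)

end Products

/-- Integer polynomials in the commuting variables `X_u = X (Sum.inl u)` and `Y_v = X (Sum.inr v)`,
indexed by words; they are evaluated at `X_u = f_u`, `Y_v = g_v`. -/
abbrev CoeffPoly (s : ℕ) : Type := MvPolynomial (FreeMonoid (Fin s) ⊕ FreeMonoid (Fin s)) ℤ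

/-- The length of the word that indexes a variable `X_u` or `Y_v`. -/
def varLength {s : ℕ} : FreeMonoid (Fin s) ⊕ FreeMonoid (Fin s) → ℕ :=
  Sum.elim FreeMonoid.length FreeMonoid.length

/-- `P` is a combination of mixed terms of order `n`: it is homogeneous of degree `n` in the
`X`-variables and of degree `n` in the `Y`-variables (a variable having as degree the length of its
word), only non-empty words of length `< n` occur, and every monomial of `P` contains some `X_u` with
`2 ≤ |u| < n` or some `Y_v` with `2 ≤ |v| < n`. -/
structure IsMixed {s : ℕ} (n : ℕ) (P : CoeffPoly s) : Prop where
  homogeneous_left : P.IsWeightedHomogeneous (Sum.elim FreeMonoid.length fun _ => 0) n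
  homogeneous_right : P.IsWeightedHomogeneous (Sum.elim (fun _ => 0) FreeMonoid.length) n
  length_lt : ∀ m ∈ P.support, ∀ z ∈ m.support, 1 ≤ varLength z ∧ varLength z < n
  exists_mixed : ∀ m ∈ P.support, ∃ z ∈ m.support, 2 ≤ varLength z ∧ varLength z < n

end MomentConvolution

end

open MomentConvolution

/-!
The recursion for the free product says that its linear extension annihilates the products
`(v₁ - φ(v₁)) ⋯ (vₘ - φ(vₘ))` of centred alternating blocks (`centered_eq_sum`), and this property
together with normalisation characterises it (`freeWord_eq_of_centered_eq_zero`). So the value of a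
free product can be established by exhibiting a function on words with this property.

Let `D` be the difference between `(f ⊠_V g)_w` and the three leading terms, computed for the
generic power series with constant term `1` over the ring of integer polynomials (`remainder`). As
the free product commutes with ring homomorphisms (`freeWord_map`), evaluating `D` at arbitrary
series gives the asserted identity, and it remains to show that `D` consists of mixed terms.
Homogeneity is immediate from the recursion. For the occurring variables, put `n = |w|` and set
some of the variables to zero, which amounts to a free product of special series.

* If `f` vanishes in the degrees `1, …, n - 1`, the free product at a word with `n` letters `x` is
  `f` at these letters, times the values of `g` at the words between them, the first and the last
  word being merged (`topMoment`). At `x_{i₁} y_{i₁} ⋯ x_{iₙ} y_{iₙ}` this is the monotone term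
  (`freeWord_interleave_of_left`). So every monomial of `D` contains some `X_u` with `|u| < n`, and
  by homogeneity no `X_u` with `|u| ≥ n`. Exchanging the roles of `x` and `y` gives the same for `Y`
  and the anti-monotone term (`freeWord_interleave_of_right`).
* If `f` and `g` vanish above degree one, the free product vanishes at every word with two adjacent
  letters of the same kind, and at an alternating word it is a number, depending on the length only,
  times the product of the values of the letters (`singleMoment`). Un-centring one letter after the
  other gives a recursion of ballot type for these numbers (`ballot`), whose solution at length `2n`
  is the signed Catalan number (`ballot_catalan`). So every monomial of `D` contains a variable
  indexed by a word of length at least two (`exists_two_le_varLength`).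
-/

namespace MomentConvolution

/-! ### Products of centred words -/

section Centered

variable {α R : Type*} [CommRing R]

/-- For functions `φ` and `G` on words, the value of the linear extension of `G` at
`p · (v₁ - φ(v₁)) ⋯ (vₘ - φ(vₘ))`, where `L = [v₁, …, vₘ]`. -/
def centered (φ G : List α → R) : List α → List (List α) → R
  | p, [] => G p
  | p, v :: L => centered φ G (p ++ v) L - φ v * centered φ G p L

theorem centered_congr_mul {φ G : List α → R} (c : R) {L : List (List α)} {p p' : List α}
    (h : ∀ r, r.Sublist L.flatten → G (p ++ r) = c * G (p' ++ r)) :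
    centered φ G p L = c * centered φ G p' L := by
  induction L generalizing p p' with
  | nil => simpa [centered] using h [] (List.Sublist.refl _)
  | cons v L ih =>
    rw [centered, centered, ih (p := p ++ v) (p' := p' ++ v), ih (p := p) (p' := p')]
    · ring
    · exact fun r hr => h r (by simpa using hr.trans (List.sublist_append_right v L.flatten))
    · intro r hr
      simpa using h (v ++ r) (by simpa using hr)

theorem centered_eq_zero {φ G : List α → R} {L : List (List α)} {p : List α}
    (h : ∀ r, r.Sublist L.flatten → G (p ++ r) = 0) : centered φ G p L = 0 := by
  rw [centered_congr_mul 0 (p' := p) (by simpa using h), zero_mul]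

theorem concatOn_cons (v : List α) (L : List (List α)) (I : Finset (Fin (L.length + 1))) :
    concatOn (v :: L) I = (if 0 ∈ I then v else []) ++
      concatOn L (Finset.univ.filter fun i => i.succ ∈ I) := by
  have h : (List.finRange (v :: L).length) = 0 :: (List.finRange L.length).map Fin.succ :=
    List.finRange_succ
  rw [concatOn, h, List.filter_cons, concatOn]
  have h2 : ((List.map Fin.succ (List.finRange L.length)).filter fun i => i ∈ I).flatMap
      (v :: L).get = ((List.finRange L.length).filter fun i => i.succ ∈ I).flatMap L.get := by
    rw [List.filter_map, List.flatMap_map]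
    rfl
  split_ifs <;> simp_all

/-- Expansion of the product of centred words over the sets of positions at which the word itself,
rather than its mean, is selected. -/
theorem centered_eq_sum (φ G : List α → R) (p : List α) (L : List (List α)) :
    centered φ G p L = ∑ I : Finset (Fin L.length),
      (-1) ^ (L.length - I.card) * G (p ++ concatOn L I) * ∏ i ∈ Iᶜ, φ (L.get i) := by
  have key : ∀ (p : List α) (L : List (List α)), centered φ G p L =
      ∑ I : Finset (Fin L.length), G (p ++ concatOn L I) * ∏ i ∈ Iᶜ, -φ (L.get i) := by
    intro p L
    induction L generalizing p with
    | nil =>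
      change G p = ∑ I : Finset (Fin 0), G (p ++ concatOn [] I) * ∏ i ∈ Iᶜ, -φ (([] : List _).get i)
      rw [Fintype.sum_eq_single (∅ : Finset (Fin 0))]
      · simp [concatOn]
      · intro I hI
        exact absurd (Subsingleton.elim _ _) hI
    | cons v L ih =>
      let e : Bool × Finset (Fin L.length) ≃ Finset (Fin (L.length + 1)) :=
        { toFun := fun x => if x.1 then insert 0 (x.2.map (Fin.succEmb _)) else
            x.2.map (Fin.succEmb _)
          invFun := fun I => (decide (0 ∈ I), Finset.univ.filter fun i => i.succ ∈ I)
          left_inv := by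
            rintro ⟨b, J⟩
            ext i <;> cases b <;> simp
          right_inv := by
            intro I
            ext i
            by_cases h : 0 ∈ I <;> refine Fin.cases ?_ (fun j => ?_) i <;> simp [h] }
      change _ = ∑ I : Finset (Fin (L.length + 1)),
        G (p ++ concatOn (v :: L) I) * ∏ i ∈ Iᶜ, -φ ((v :: L).get i)
      rw [centered, ih, ih, ← e.sum_comp, Fintype.sum_prod_type, Fintype.sum_bool,
        sub_eq_add_neg, Finset.mul_sum, ← Finset.sum_neg_distrib]
      have hc : ∀ b J, (e (b, J))ᶜ = e (!b, Jᶜ) := by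
        intro b J
        ext i
        cases b <;> refine Fin.cases ?_ (fun j => ?_) i <;> simp [e]
      have h1 : ∀ b J, (Finset.univ.filter fun i => i.succ ∈ e (b, J)) = J := by
        intro b J
        ext i
        cases b <;> simp [e]
      congr 1 <;> refine Finset.sum_congr rfl fun J _ => ?_
      · rw [concatOn_cons, h1, hc]
        simp [e]
      · rw [concatOn_cons, h1, hc]
        simp [e]
        ring
  rw [key]
  refine Finset.sum_congr rfl fun I _ => ?_
  rw [Finset.prod_neg, Finset.card_compl, Fintype.card_fin]
  ring

end Centered

/-! ### Alternating lists of blocks -/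

section Blocks

variable {α : Type*}

/-- `L` is a list of non-empty words, each consisting of letters of a single colour with respect to
`q`, the colours alternating along `L` and the first one being `c` (no condition on `c` if `L` is
empty). -/
inductive AltBlocks (q : α → Bool) : Bool → List (List α) → Prop
  | nil (c : Bool) : AltBlocks q c []
  | cons {c : Bool} {v : List α} {L : List (List α)} : v ≠ [] → (∀ a ∈ v, q a = c) →
      AltBlocks q (!c) L → AltBlocks q c (v :: L)

theorem AltBlocks.not {q : α → Bool} {c : Bool} {L : List (List α)} (h : AltBlocks q c L) :
    AltBlocks (fun a => !q a) (!c) L := by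
  induction h with
  | nil c => exact .nil _
  | cons h1 h2 _ ih => exact .cons h1 (fun a ha => by rw [h2 a ha]) ih

theorem altBlocks_splitBy (q : α → Bool) (u : List α) :
    ∃ c, AltBlocks q c (u.splitBy fun a b => q a == q b) := by
  have h1 := List.nil_notMem_splitBy (fun a b => q a == q b) u
  have h2 := fun m => List.isChain_of_mem_splitBy (m := m) (r := fun a b => q a == q b) (l := u)
  have h3 := List.isChain_getLast_head_splitBy (fun a b => q a == q b) u
  generalize (u.splitBy fun a b => q a == q b) = L at h1 h2 h3
  have mono : ∀ m ∈ L, ∀ a ∈ m, ∀ b ∈ m, q a = q b := by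
    intro m hm a ha b hb
    have h := h2 m hm
    simp only [beq_iff_eq] at h
    have : IsTrans α (fun x y => q x = q y) := ⟨fun _ _ _ h h' => h.trans h'⟩
    have : Std.Symm (fun x y => q x = q y) := ⟨fun _ _ h => h.symm⟩
    exact h.pairwise.forall_of_forall (R := fun x y => q x = q y) (fun _ _ => rfl) ha hb
  clear h2
  induction L with
  | nil => exact ⟨true, .nil _⟩
  | cons v L ih =>
    obtain ⟨c, hc⟩ := ih (fun h => h1 (List.mem_cons_of_mem _ h)) h3.tail
      (fun m hm => mono m (List.mem_cons_of_mem _ hm))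
    have hv : v ≠ [] := fun h => h1 (h ▸ List.mem_cons_self)
    have hv' : ∀ a ∈ v, q a = q (v.getLast hv) := fun a ha =>
      mono v List.mem_cons_self a ha _ (List.getLast_mem hv)
    refine ⟨q (v.getLast hv), .cons hv hv' ?_⟩
    cases hc with
    | nil => exact .nil _
    | @cons c v' L h4 h5 h6 =>
      obtain ⟨ha, hb, h⟩ := (List.isChain_cons_cons.1 h3).1
      have : c = !q (v.getLast hv) := by
        rw [h5 _ (List.head_mem hb)] at h
        revert h
        cases c <;> cases q (v.getLast hv) <;> simp
      subst this
      exact .cons h4 h5 h6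

end Blocks

/-! ### The characterisation of the free product -/

section FreeWord

variable {R : Type*} [CommRing R] {s : ℕ}

/-- The defining recursion of the free product, without the attached membership proofs. -/
theorem freeWord_of_ne_nil (f g : NCSeries R s) {u : List (Letter s)} (hu : u ≠ []) :
    freeWord f g u = ∑ I ∈ (Finset.univ : Finset (Fin (blocks u).length)).ssubsets,
      (-1) ^ ((blocks u).length - I.card + 1) * freeWord f g (concatOn (blocks u) I) *
        ∏ i ∈ Iᶜ, blockValue f g ((blocks u).get i) := by
  rw [freeWord, if_neg hu]
  exact Finset.sum_attach _ fun I => (-1) ^ ((blocks u).length - I.card + 1) *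
    freeWord f g (concatOn (blocks u) I) * ∏ i ∈ Iᶜ, blockValue f g ((blocks u).get i)

theorem freeWord_nil (f g : NCSeries R s) : freeWord f g [] = 1 := by
  rw [freeWord, if_pos rfl]

theorem concatOn_univ {α : Type*} (L : List (List α)) : concatOn L Finset.univ = L.flatten := by
  simp only [concatOn, Finset.mem_univ, decide_true, List.filter_true]
  rw [List.flatMap_def, List.map_get_finRange]

theorem concatOn_sublist {α : Type*} (L : List (List α)) (I : Finset (Fin L.length)) :
    (concatOn L I).Sublist L.flatten := by
  rw [← concatOn_univ]
  unfold concatOn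
  refine List.Sublist.flatMap ?_ _
  simp

theorem flatten_blocks (u : List (Letter s)) : (blocks u).flatten = u :=
  List.flatten_splitBy _ _

/-- The free product is the only normalised function on words that annihilates the products of
centred alternating blocks. It suffices to check this on a class `C` of words closed under
sublists. -/
theorem freeWord_eq_of_centered_eq_zero (f g : NCSeries R s) (C : List (Letter s) → Prop)
    (hC : ∀ u v, v.Sublist u → C u → C v) (G : List (Letter s) → R) (hG : G [] = 1)
    (h : ∀ u, C u → u ≠ [] → centered (blockValue f g) G [] (blocks u) = 0)
    (u : List (Letter s)) (hu : C u) : freeWord f g u = G u := by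
  induction hn : u.length using Nat.strong_induction_on generalizing u with
  | _ n ih =>
    by_cases h0 : u = []
    · rw [h0, hG, freeWord_nil]
    have hc := h u hu h0
    have hs : (Finset.univ : Finset (Fin (blocks u).length)).ssubsets =
        Finset.univ.erase Finset.univ := by
      rw [Finset.ssubsets, Finset.powerset_univ]
    rw [centered_eq_sum, ← Finset.add_sum_erase _ _ (Finset.mem_univ Finset.univ), ← hs,
      List.nil_append, concatOn_univ, flatten_blocks, Finset.card_univ, Fintype.card_fin,
      Nat.sub_self, pow_zero, one_mul, Finset.compl_univ, Finset.prod_empty, mul_one] at hc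
    rw [freeWord_of_ne_nil _ _ h0, eq_neg_of_add_eq_zero_left hc, ← Finset.sum_neg_distrib]
    refine Finset.sum_congr rfl fun I hI => ?_
    have hI' := concatOn_sublist (blocks u) I
    rw [flatten_blocks] at hI'
    rw [ih _ (hn ▸ length_concatOn_blocks_lt u I (Finset.mem_ssubsets.1 hI)) _ (hC _ _ hI' hu) rfl,
      List.nil_append]
    ring

/-- The free product commutes with ring homomorphisms, hence is given by universal polynomials. -/
theorem freeWord_map {S : Type*} [CommRing S] (φ : R →+* S) (f g : NCSeries R s)
    (u : List (Letter s)) :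
    freeWord (fun v => φ (f v)) (fun v => φ (g v)) u = φ (freeWord f g u) := by
  induction hn : u.length using Nat.strong_induction_on generalizing u with
  | _ n ih =>
    by_cases h0 : u = []
    · rw [h0, freeWord_nil, freeWord_nil, map_one]
    rw [freeWord_of_ne_nil _ _ h0, freeWord_of_ne_nil _ _ h0, map_sum]
    refine Finset.sum_congr rfl fun I hI => ?_
    rw [ih _ (hn ▸ length_concatOn_blocks_lt u I (Finset.mem_ssubsets.1 hI)) _ rfl, map_mul,
      map_mul, map_pow, map_neg, map_one, map_prod]
    congr 1
    refine Finset.prod_congr rfl fun i _ => ?_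
    rw [blockValue, blockValue, apply_ite φ]

end FreeWord

/-! ### The free product when one functional vanishes below the top degree -/

section Gap

variable {α R : Type*} [CommRing R]

/-- The product of the values of `φ` at the maximal words without special letters (`q a = true`)
in `acc ++ u`, read from a point just behind a special letter; the last of them, which no special
letter closes, is merged with the word `l`. -/
def gapProd (q : α → Bool) (φ : List α → R) (l : List α) : List α → List α → R
  | acc, [] => φ (l ++ acc)
  | acc, a :: u => if q a then φ acc * gapProd q φ l [] u else gapProd q φ l (acc ++ [a]) u

/-- The product of the values of `φ` at the maximal words without special letters in `l ++ u`, the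
outermost two of them, to the left and to the right of all special letters, being merged. -/
def outerGapProd (q : α → Bool) (φ : List α → R) : List α → List α → R
  | l, [] => φ l
  | l, a :: u => if q a then gapProd q φ l [] u else outerGapProd q φ (l ++ [a]) u

theorem outerGapProd_append (q : α → Bool) (φ : List α → R) (l v u : List α)
    (hv : ∀ a ∈ v, q a = false) : outerGapProd q φ l (v ++ u) = outerGapProd q φ (l ++ v) u := by
  induction v generalizing l with
  | nil => simp
  | cons a v ih =>
    rw [List.cons_append, outerGapProd, hv a List.mem_cons_self, if_neg (by simp),
      ih _ fun b hb => hv b (List.mem_cons_of_mem _ hb)]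
    simp

theorem gapProd_append (q : α → Bool) (φ : List α → R) (l acc v u : List α)
    (hv : ∀ a ∈ v, q a = false) : gapProd q φ l acc (v ++ u) = gapProd q φ l (acc ++ v) u := by
  induction v generalizing acc with
  | nil => simp
  | cons a v ih =>
    rw [List.cons_append, gapProd, hv a List.mem_cons_self, if_neg (by simp),
      ih _ fun b hb => hv b (List.mem_cons_of_mem _ hb)]
    simp

theorem gapProd_special_append (q : α → Bool) (φ : List α → R) (hφ : φ [] = 1)
    (l acc x u : List α) (hx : ∀ a ∈ x, q a = true) (hx0 : x ≠ []) :
    gapProd q φ l acc (x ++ u) = φ acc * gapProd q φ l [] u := by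
  induction x generalizing acc with
  | nil => exact absurd rfl hx0
  | cons a x ih =>
    rw [List.cons_append, gapProd, hx a List.mem_cons_self, if_pos rfl]
    by_cases hx1 : x = []
    · rw [hx1, List.nil_append]
    · rw [ih _ (fun b hb => hx b (List.mem_cons_of_mem _ hb)) hx1, hφ, one_mul]

theorem outerGapProd_special_append (q : α → Bool) (φ : List α → R) (hφ : φ [] = 1)
    (l x u : List α) (hx : ∀ a ∈ x, q a = true) (hx0 : x ≠ []) :
    outerGapProd q φ l (x ++ u) = gapProd q φ l [] u := by
  obtain ⟨a, x, rfl⟩ := List.exists_cons_of_ne_nil hx0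
  rw [List.cons_append, outerGapProd, hx a List.mem_cons_self, if_pos rfl]
  by_cases hx1 : x = []
  · rw [hx1, List.nil_append]
  · rw [gapProd_special_append q φ hφ _ _ _ _ (fun b hb => hx b (List.mem_cons_of_mem _ hb)) hx1,
      hφ, one_mul]

/-- The free product in the case that `φ` vanishes on the non-empty words in special letters of
length less than `n`, as a function on the words with at most `n` special letters. -/
def topMoment (q : α → Bool) (φ : List α → R) (n : ℕ) (u : List α) : R :=
  if u.countP q = 0 ∨ u.countP q = n then φ (u.filter q) * outerGapProd q φ [] u else 0

theorem filter_of_special {q : α → Bool} {x : List α} (hx : ∀ a ∈ x, q a = true) :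
    x.filter q = x := List.filter_eq_self.2 hx

theorem filter_of_not_special {q : α → Bool} {y : List α} (hy : ∀ a ∈ y, q a = false) :
    y.filter q = [] := by
  simpa [List.filter_eq_nil_iff] using hy

theorem countP_of_special {q : α → Bool} {x : List α} (hx : ∀ a ∈ x, q a = true) :
    x.countP q = x.length := List.countP_eq_length.2 hx

theorem countP_of_not_special {q : α → Bool} {y : List α} (hy : ∀ a ∈ y, q a = false) :
    y.countP q = 0 := by
  simpa [List.countP_eq_zero] using hy

variable {q : α → Bool} {φ : List α → R} {n : ℕ}

theorem topMoment_of_not_special (hφ : φ [] = 1) {y : List α} (hy : ∀ a ∈ y, q a = false) :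
    topMoment q φ n y = φ y := by
  rw [topMoment, if_pos (Or.inl (countP_of_not_special hy)), filter_of_not_special hy, hφ, one_mul]
  have := outerGapProd_append q φ [] y [] hy
  rw [List.append_nil] at this
  rw [this, List.nil_append, outerGapProd]

/-- The case of a single block of special letters. -/
theorem topMoment_single (hφ : φ [] = 1) {l x t : List α} (hl : ∀ a ∈ l, q a = false)
    (hx : ∀ a ∈ x, q a = true) (hx0 : x ≠ []) (hn : x.length = n) (ht : ∀ a ∈ t, q a = false) :
    topMoment q φ n (l ++ x ++ t) = φ x * φ (l ++ t) := by
  rw [topMoment, if_pos]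
  · rw [List.append_assoc, outerGapProd_append _ _ _ _ _ hl,
      outerGapProd_special_append _ _ hφ _ _ _ hx hx0]
    have := gapProd_append q φ ([] ++ l) [] t [] ht
    rw [List.append_nil] at this
    rw [this, gapProd, List.filter_append, List.filter_append, filter_of_special hx,
      filter_of_not_special hl, filter_of_not_special ht]
    simp
  · right
    rw [List.countP_append, List.countP_append, countP_of_special hx, countP_of_not_special hl,
      countP_of_not_special ht]
    omega

/-- A word enclosed by special letters factors out. -/
theorem topMoment_enclosed (hφ : φ [] = 1) {l x y z r : List α} (hl : ∀ a ∈ l, q a = false)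
    (hx : ∀ a ∈ x, q a = true) (hx0 : x ≠ []) (hy : ∀ a ∈ y, q a = false)
    (hz : ∀ a ∈ z, q a = true) (hz0 : z ≠ []) :
    topMoment q φ n (l ++ x ++ y ++ z ++ r) = φ y * topMoment q φ n (l ++ x ++ z ++ r) := by
  have hc : (l ++ x ++ y ++ z ++ r).countP q = (l ++ x ++ z ++ r).countP q := by
    simp [List.countP_append, countP_of_not_special hy]
  have hf : (l ++ x ++ y ++ z ++ r).filter q = (l ++ x ++ z ++ r).filter q := by
    simp [List.filter_append, filter_of_not_special hy]
  have ho : outerGapProd q φ [] (l ++ x ++ y ++ z ++ r) =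
      φ y * outerGapProd q φ [] (l ++ x ++ z ++ r) := by
    simp only [List.append_assoc]
    rw [outerGapProd_append _ _ _ _ _ hl, outerGapProd_append _ _ _ _ _ hl,
      outerGapProd_special_append _ _ hφ _ _ _ hx hx0,
      outerGapProd_special_append _ _ hφ _ _ _ hx hx0, gapProd_append _ _ _ _ _ _ hy,
      gapProd_special_append _ _ hφ _ _ _ _ hz hz0, gapProd_special_append _ _ hφ _ _ _ _ hz hz0,
      hφ, List.nil_append, one_mul]
  rw [topMoment, topMoment, hc, hf, ho]
  split_ifs <;> ring

theorem topMoment_eq_zero {u : List α} (h0 : u.countP q ≠ 0) (hn : u.countP q ≠ n) :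
    topMoment q φ n u = 0 := by
  rw [topMoment, if_neg (by tauto)]

/-- `x` is the first block of special letters and has fewer than `n` of them. Either too few special
letters follow, and all terms vanish, or the next word without special letters is enclosed; as it
factors out, its centring annihilates the expression. -/
theorem centered_topMoment_of_short (hφ : φ [] = 1)
    (hv : ∀ v : List α, (∀ a ∈ v, q a = true) → v ≠ [] → v.length < n → φ v = 0)
    {l x : List α} {L : List (List α)} (hl : ∀ a ∈ l, q a = false)
    (hx : ∀ a ∈ x, q a = true) (hx0 : x ≠ []) (hxn : x.length < n) (hL : AltBlocks q false L)
    (hc : x.length + L.flatten.countP q ≤ n) :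
    centered φ (topMoment q φ n) l (x :: L) = 0 := by
  have hpos := List.length_pos_iff.2 hx0
  rw [centered, hv x hx hx0 hxn, zero_mul, sub_zero]
  by_cases hlt : x.length + L.flatten.countP q < n
  · refine centered_eq_zero fun r hr => ?_
    have := hr.countP_le (p := q)
    apply topMoment_eq_zero <;>
      simp only [List.countP_append, countP_of_special hx, countP_of_not_special hl] <;> omega
  cases hL with
  | nil => simp at hc hlt; omega
  | @cons _ y L hy0 hy hL =>
    cases hL with
    | nil =>
      simp [countP_of_not_special hy] at hlt
      omega
    | @cons _ z L hz0 hz hL =>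
      have hz : ∀ a ∈ z, q a = true := hz
      have hzn : z.length < n := by
        simp only [List.flatten_cons, List.countP_append, countP_of_special hz] at hc
        omega
      rw [centered, centered, centered, hv z hz hz0 hzn, zero_mul, sub_zero, zero_mul, sub_zero,
        sub_eq_zero]
      exact centered_congr_mul _ fun r _ => topMoment_enclosed hφ hl hx hx0 hy hz hz0

/-- `x` is the only block of special letters, hence at most one further block follows. -/
theorem centered_topMoment_of_long (hφ : φ [] = 1) {l x : List α} {L : List (List α)}
    (hl : ∀ a ∈ l, q a = false) (hx : ∀ a ∈ x, q a = true) (hx0 : x ≠ [])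
    (hxn : x.length = n) (hL : AltBlocks q false L) (hc : x.length + L.flatten.countP q ≤ n) :
    centered φ (topMoment q φ n) l (x :: L) = 0 := by
  have h1 := topMoment_single hφ (t := []) hl hx hx0 hxn (by simp)
  rw [List.append_nil, List.append_nil] at h1
  cases hL with
  | nil => rw [centered, centered, centered, h1, topMoment_of_not_special hφ hl, sub_self]
  | @cons _ t L ht0 ht hL =>
    cases hL with
    | nil =>
      simp only [centered]
      rw [h1, topMoment_single hφ hl hx hx0 hxn ht, topMoment_of_not_special hφ hl,
        topMoment_of_not_special hφ]
      · ring
      · exact fun a ha => (List.mem_append.1 ha).elim (hl a) (ht a)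
    | @cons _ z L hz0 hz hL =>
      have hz : ∀ a ∈ z, q a = true := hz
      have := List.length_pos_iff.2 hz0
      simp only [List.flatten_cons, List.countP_append, countP_of_special hz] at hc
      omega

/-- `topMoment` annihilates the products of centred alternating blocks with at most `n` special
letters, provided that `φ` vanishes on the shorter words in special letters. -/
theorem centered_topMoment (hφ : φ [] = 1)
    (hv : ∀ v : List α, (∀ a ∈ v, q a = true) → v ≠ [] → v.length < n → φ v = 0)
    {c : Bool} {L : List (List α)} (hL : AltBlocks q c L) (hL0 : L ≠ [])
    (hc : L.flatten.countP q ≤ n) : centered φ (topMoment q φ n) [] L = 0 := by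
  have key : ∀ (l x : List α) (L : List (List α)), (∀ a ∈ l, q a = false) →
      (∀ a ∈ x, q a = true) → x ≠ [] → AltBlocks q false L → x.length + L.flatten.countP q ≤ n →
      centered φ (topMoment q φ n) l (x :: L) = 0 := by
    intro l x L hl hx hx0 hL hc
    rcases Nat.lt_or_ge x.length n with h | h
    · exact centered_topMoment_of_short hφ hv hl hx hx0 h hL hc
    · exact centered_topMoment_of_long hφ hl hx hx0 (by omega) hL hc
  cases hL with
  | nil => exact absurd rfl hL0
  | @cons _ v L hv0 hvc hL =>
    rw [List.flatten_cons, List.countP_append] at hc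
    cases c with
    | true =>
      rw [countP_of_special hvc] at hc
      exact key [] v L (by simp) hvc hv0 hL hc
    | false =>
      cases hL with
      | nil =>
        rw [centered, centered, centered, List.nil_append, topMoment_of_not_special hφ hvc,
          topMoment_of_not_special hφ (by simp), hφ, mul_one, sub_self]
      | @cons _ x L hx0 hx hL =>
        rw [List.flatten_cons, List.countP_append, countP_of_special hx] at hc
        rw [centered, List.nil_append, key v x L hvc hx hx0 hL (by omega),
          key [] x L (by simp) hx hx0 hL (by omega), mul_zero, sub_zero]

end Gap

/-! ### The free product when both functionals vanish above degree one -/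

section Single

variable {α R : Type*} [CommRing R]

/-- Signed ballot numbers. When `φ` vanishes on words of length at least two, `ballot k j` is the
coefficient of the product of the single-letter values in the value of the free product at an
alternating word of `k + 1` letters followed by `j` centred letters (see
`centered_singleMoment_map`). The initial condition says that a single letter followed by centred
ones has value zero; the recursion results from un-centring the first of the centred letters. -/
def ballot : ℕ → ℕ → ℤ
  | 0, j => if j = 0 then 1 else 0
  | k + 1, 0 => ballot k 0 + ballot k 1
  | k + 1, j + 1 => ballot k (j + 2) - ballot k j

theorem ballot_add_two_zero (k : ℕ) : ballot (k + 2) 0 = ballot k 1 + ballot k 2 := by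
  simp only [ballot]
  ring

theorem ballot_add_two_one (k : ℕ) :
    ballot (k + 2) 1 = ballot k 3 - 2 * ballot k 1 - ballot k 0 := by
  simp only [ballot]
  ring

theorem ballot_add_two_add_two (k j : ℕ) :
    ballot (k + 2) (j + 2) = ballot k (j + 4) - 2 * ballot k (j + 2) + ballot k j := by
  simp only [ballot]
  ring

/-- Closed form of the odd rows of `ballot`; consecutive entries cancel in pairs. -/
theorem ballot_eq_choose (n j : ℕ) :
    ballot (2 * n + 1) (2 * j) = (-1) ^ (n + j) * ((2 * n).choose (n + j) -
      (2 * n).choose (n + j + 1) : ℤ) ∧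
    ballot (2 * n + 1) (2 * j + 1) = -((-1) ^ (n + j) * ((2 * n).choose (n + j) -
      (2 * n).choose (n + j + 1) : ℤ)) := by
  induction n generalizing j with
  | zero =>
    cases j with
    | zero => simp [ballot]
    | succ j => simp [ballot, Nat.mul_add]
  | succ n ih =>
    have h2 : 2 * (n + 1) + 1 = 2 * n + 1 + 2 := by ring
    have hc : ∀ i, ((2 * (n + 1)).choose (i + 2) : ℤ) = (2 * n).choose i +
        2 * (2 * n).choose (i + 1) + (2 * n).choose (i + 2) := by
      intro i
      rw [show 2 * (n + 1) = 2 * n + 1 + 1 by ring, Nat.choose_succ_succ, Nat.choose_succ_succ,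
        Nat.choose_succ_succ]
      push_cast
      ring
    rw [h2]
    cases j with
    | zero =>
      have h0 : ((2 * (n + 1)).choose (n + 1) : ℤ) =
          2 * (2 * n).choose n + 2 * (2 * n).choose (n + 1) := by
        rw [show 2 * (n + 1) = 2 * n + 1 + 1 by ring, Nat.choose_succ_succ,
          ← Nat.choose_symm_half, Nat.choose_succ_succ]
        push_cast
        ring
      have ha := ih 0
      have hb := ih 1
      have e1 := hc n
      simp only [mul_zero, mul_one, zero_add, add_zero, Nat.reduceAdd] at ha hb ⊢
      rw [ballot_add_two_zero, ballot_add_two_one, ha.1, ha.2, hb.1, hb.2, h0, e1]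
      constructor <;> ring
    | succ j =>
      have hb := ih j
      have hd := ih (j + 1)
      have he := ih (j + 2)
      have e1 := hc (n + j)
      have e2 := hc (n + j + 1)
      rw [show 2 * (j + 1) + 1 = 2 * j + 1 + 2 by ring, show 2 * (j + 1) = 2 * j + 2 by ring,
        show n + (j + 1) = n + j + 1 by ring] at hd
      rw [show 2 * (j + 2) + 1 = 2 * j + 1 + 4 by ring, show 2 * (j + 2) = 2 * j + 4 by ring,
        show n + (j + 2) = n + j + 2 by ring] at he
      rw [show 2 * (j + 1) + 1 = 2 * j + 1 + 2 by ring, show 2 * (j + 1) = 2 * j + 2 by ring,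
        ballot_add_two_add_two, ballot_add_two_add_two, hb.1, hb.2, hd.1, hd.2, he.1, he.2,
        show n + 1 + (j + 1) = n + j + 2 by ring, e1,
        show n + j + 2 + 1 = n + j + 1 + 2 by ring, e2]
      constructor <;> ring

theorem ballot_catalan (n : ℕ) : ballot (2 * n + 1) 0 = (-1) ^ n * (catalan n : ℤ) := by
  have h := (ballot_eq_choose n 0).1
  simp only [mul_zero, add_zero] at h
  rw [h]
  congr 1
  have h1 := succ_mul_catalan_eq_centralBinom n
  rw [Nat.centralBinom_eq_two_mul_choose] at h1
  have h2 := Nat.choose_succ_right_eq (2 * n) n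
  rw [show 2 * n - n = n by omega] at h2
  have h3 : ((n : ℤ) + 1) ≠ 0 := by positivity
  apply mul_left_cancel₀ h3
  zify at h1 h2
  linear_combination - h2 - h1

/-- The free product in the case that `φ` vanishes on all words of length at least two: it is
supported on the words in which the colours given by `q` alternate. -/
def singleMoment (q : α → Bool) (φ : List α → R) (u : List α) : R :=
  if u.IsChain (fun a b => q a ≠ q b) then
    (ballot (u.length - 1) 0 : R) * (u.map fun a => φ [a]).prod else 0

variable {q : α → Bool} {φ : List α → R}

theorem centered_singleMoment_of_not_isChain {p : List α} (L : List (List α))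
    (hp : ¬ p.IsChain (fun a b => q a ≠ q b)) : centered φ (singleMoment q φ) p L = 0 :=
  centered_eq_zero fun _ _ => if_neg fun h => hp h.left_of_append

theorem centered_singleMoment_of_long 
    (hv : ∀ v : List α, (∃ c, ∀ a ∈ v, q a = c) → 2 ≤ v.length → φ v = 0) {c : Bool}
    {L : List (List α)} (hL : AltBlocks q c L) {v : List α} (hvL : v ∈ L) (h : 2 ≤ v.length)
    (p : List α) : centered φ (singleMoment q φ) p L = 0 := by
  induction hL generalizing p with
  | nil c => simp at hvL
  | @cons c w L _ hwc _ ih =>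
    rcases List.mem_cons.1 hvL with rfl | hvL
    · rw [centered, hv v ⟨_, hwc⟩ h, zero_mul, sub_zero]
      refine centered_singleMoment_of_not_isChain _ fun hch => ?_
      match v, h with
      | a :: b :: v, _ =>
        have := hch.right_of_append
        rw [List.isChain_cons_cons] at this
        exact this.1 ((hwc a (by simp)).trans (hwc b (by simp)).symm)
    · rw [centered, ih hvL, ih hvL, mul_zero, sub_zero]

/-- If all blocks are single letters, the colours alternate along the word. -/
theorem AltBlocks.isChain_flatten {c : Bool} {L : List (List α)} (hL : AltBlocks q c L)
    (h : ∀ v ∈ L, v.length < 2) : L.flatten.IsChain (fun a b => q a ≠ q b) ∧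
      ∀ a ∈ L.flatten.head?, q a = c := by
  induction hL with
  | nil => simp
  | @cons c v L hv hvc _ ih =>
    obtain ⟨a, rfl⟩ : ∃ a, v = [a] := by
      have := h v List.mem_cons_self
      have := List.length_pos_iff.2 hv
      exact List.length_eq_one_iff.1 (by omega)
    obtain ⟨h1, h2⟩ := ih fun v hv => h v (List.mem_cons_of_mem _ hv)
    have ha := hvc a (by simp)
    rw [List.flatten_cons, List.singleton_append]
    refine ⟨List.isChain_cons.2 ⟨fun b hb => ?_, h1⟩, by simpa using ha⟩
    rw [ha, h2 b hb]
    simp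

theorem centered_singleMoment_map (p u : List α) (x : α)
    (h : (p ++ x :: u).IsChain (fun a b => q a ≠ q b)) :
    centered φ (singleMoment q φ) (p ++ [x]) (u.map fun a => [a]) =
      (ballot p.length u.length : R) * ((p ++ x :: u).map fun a => φ [a]).prod := by
  induction hn : u.length using Nat.strong_induction_on generalizing p u x with
  | _ n ih =>
    match u with
    | [] =>
      rw [List.map_nil, centered, singleMoment, if_pos h, ← hn]
      simp
    | [a] =>
      have h1 : (p ++ [x]).IsChain (fun a b => q a ≠ q b) := by
        rw [← List.singleton_append, ← List.append_assoc] at h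
        exact h.left_of_append
      have h2 : (p ++ [x] ++ [a]).IsChain (fun a b => q a ≠ q b) := by simpa using h
      simp only [List.map_cons, List.map_nil, centered]
      rw [singleMoment, singleMoment, if_pos h1, if_pos h2, ← hn]
      simp [ballot]
      ring
    | a :: b :: u =>
      subst hn
      -- The letters `x` and `b` have the same colour, opposite to that of `a`.
      have h1 : (p ++ x :: u).IsChain (fun a b => q a ≠ q b) := by
        rw [List.isChain_append] at h ⊢
        refine ⟨h.1, ?_, by simpa using h.2.2⟩
        have h' := h.2.1
        cases u with
        | nil => exact .singleton _
        | cons d u =>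
          simp only [List.isChain_cons_cons] at h' ⊢
          refine ⟨?_, h'.2.2.2⟩
          have h3 := h'.1
          have h4 := h'.2.1
          have h5 := h'.2.2.1
          revert h3 h4 h5
          cases q x <;> cases q a <;> cases q b <;> cases q d <;> simp
      have h2 : ¬ (p ++ [x] ++ [b]).IsChain (fun a b => q a ≠ q b) := by
        intro hb
        rw [List.append_assoc] at hb
        have h' := h.right_of_append
        have hb := hb.right_of_append
        simp only [List.singleton_append, List.isChain_cons_cons] at h' hb
        have h3 := h'.1
        have h4 := h'.2.1
        have h5 := hb.1
        revert h3 h4 h5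
        cases q x <;> cases q a <;> cases q b <;> simp
      have e1 := ih _ (by simp) (p ++ [x]) (b :: u) a (by simpa using h) rfl
      have e2 := ih _ (by simp) p u x h1 rfl
      simp only [List.map_cons, centered] at e1 ⊢
      rw [e1, e2, centered_singleMoment_of_not_isChain _ h2]
      simp [ballot]
      ring

theorem centered_singleMoment_nil (u : List α) (hu : u ≠ [])
    (h : u.IsChain (fun a b => q a ≠ q b)) :
    centered φ (singleMoment q φ) [] (u.map fun a => [a]) = 0 := by
  induction u with
  | nil => exact absurd rfl hu
  | cons a u ih =>
    have := centered_singleMoment_map (φ := φ) [] u a h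
    rw [List.map_cons, centered, this]
    by_cases hu : u = []
    · simp [hu, centered, singleMoment, ballot]
    · rw [ih hu h.tail]
      simp [ballot, hu]

end Single

/-! ### Values on blocks -/

section BlockValue

variable {R : Type*} {s : ℕ} {f g : NCSeries R s}

theorem xPart_length (u : List (Letter s)) :
    (xPart u).length = u.countP fun a => a.isLeft := by
  change (u.filterMap Sum.getLeft?).length = _
  induction u with
  | nil => rfl
  | cons a u ih =>
    rw [List.countP_cons, ← ih]
    cases a <;> rfl

theorem yPart_length (u : List (Letter s)) :
    (yPart u).length = u.countP fun a => !a.isLeft := by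
  change (u.filterMap Sum.getRight?).length = _
  induction u with
  | nil => rfl
  | cons a u ih =>
    rw [List.countP_cons, ← ih]
    cases a <;> rfl

theorem xPart_filter (u : List (Letter s)) : xPart (u.filter fun a => a.isLeft) = xPart u := by
  rw [xPart, xPart, List.filterMap_filter]
  congr 2
  funext a
  cases a <;> rfl

theorem yPart_filter (u : List (Letter s)) : yPart (u.filter fun a => !a.isLeft) = yPart u := by
  rw [yPart, yPart, List.filterMap_filter]
  congr 2
  funext a
  cases a <;> rfl

theorem blockValue_of_isLeft {v : List (Letter s)} (hv : ∀ a ∈ v, a.isLeft = true) :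
    blockValue f g v = f (xPart v) := by
  rw [blockValue, if_pos]
  rw [yPart_length, List.countP_eq_zero]
  simpa using hv

theorem blockValue_of_not_isLeft {v : List (Letter s)} (hv : ∀ a ∈ v, a.isLeft = false)
    (hv0 : v ≠ []) : blockValue f g v = g (yPart v) := by
  rw [blockValue, if_neg]
  rw [yPart_length, List.countP_eq_length.2 (by simpa using hv)]
  exact fun h => hv0 (List.length_eq_zero_iff.1 h)

theorem xPart_length_of_isLeft {v : List (Letter s)} (hv : ∀ a ∈ v, a.isLeft = true) :
    (xPart v).length = v.length := by
  rw [xPart_length, List.countP_eq_length.2 hv]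

theorem yPart_length_of_not_isLeft {v : List (Letter s)} (hv : ∀ a ∈ v, a.isLeft = false) :
    (yPart v).length = v.length := by
  rw [yPart_length, List.countP_eq_length.2 (by simpa using hv)]

theorem blockValue_inl (i : Fin s) : blockValue f g [Sum.inl i] = f (.of i) := rfl

theorem blockValue_inr (i : Fin s) : blockValue f g [Sum.inr i] = g (.of i) := rfl

end BlockValue

/-! ### The convolutions as values at the words `x_{i₁} y_{i₁} ⋯ x_{iₙ} y_{iₙ}` -/

section Interleave

variable {R : Type*} [CommRing R] {s : ℕ}

/-- The word `x_{i₁} y_{i₁} ⋯ x_{iₙ} y_{iₙ}`, the image of `x_{i₁} ⋯ x_{iₙ}` under `Δ_m`. -/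
def interleave (w : List (Fin s)) : List (Letter s) :=
  w.flatMap fun i => [Sum.inl i, Sum.inr i]

theorem functional_lift_ι {X : Type*} (h : FreeMonoid X → R) (u : FreeMonoid X) :
    functional h (FreeMonoid.lift (FreeAlgebra.ι R) u) = h u := by
  have h1 : FreeAlgebra.equivMonoidAlgebraFreeMonoid (FreeMonoid.lift (FreeAlgebra.ι R) u) =
      MonoidAlgebra.of R (FreeMonoid X) u := by
    induction u using FreeMonoid.inductionOn' with
    | one => rw [map_one, map_one, map_one]
    | of_mul x u ih =>
      rw [map_mul, map_mul, map_mul, ih]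
      simp [FreeAlgebra.equivMonoidAlgebraFreeMonoid]
  have : FreeMonoid.lift (FreeAlgebra.ι R) u = FreeAlgebra.basisFreeMonoid R X u := by
    rw [FreeAlgebra.basisFreeMonoid, Module.Basis.map_apply, LinearEquiv.eq_symm_apply]
    change (FreeAlgebra.equivMonoidAlgebraFreeMonoid (FreeMonoid.lift (FreeAlgebra.ι R) u)).coeff =
      _
    rw [h1]
    simp
  rw [this, functional, Module.Basis.constr_basis]

theorem convM_functional (h : FreeMonoid (Letter s) → R) (w : FreeMonoid (Fin s)) :
    convM (functional h) w = h (FreeMonoid.ofList (interleave w.toList)) := by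
  rw [convM, ← functional_lift_ι h]
  congr 1
  induction w using FreeMonoid.inductionOn' with
  | one => simp [interleave]
  | of_mul i w ih =>
    rw [map_mul, map_mul, ih]
    simp [comulM, interleave, mul_assoc]

theorem isChain_interleave (w : List (Fin s)) :
    (interleave w).IsChain fun a b => a.isLeft ≠ b.isLeft := by
  induction w with
  | nil => exact .nil
  | cons i w ih =>
    cases w with
    | nil => simp [interleave]
    | cons j w =>
      simp only [interleave, List.flatMap_cons, List.cons_append, List.nil_append,
        List.isChain_cons_cons] at ih ⊢
      exact ⟨by simp, by simp, ih⟩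

theorem blocks_of_isChain {u : List (Letter s)} (h : u.IsChain fun a b => a.isLeft ≠ b.isLeft) :
    blocks u = u.map fun a => [a] := by
  rw [blocks, List.splitBy_eq_iff]
  refine ⟨by simp [← List.flatMap_def], by simp, fun m hm => ?_, ?_⟩
  · obtain ⟨a, -, rfl⟩ := List.mem_map.1 hm
    exact .singleton a
  rw [List.isChain_map]
  exact h.imp fun a b hab => ⟨by simp, by simp, by simpa using hab⟩

theorem xPart_interleave (w : List (Fin s)) : xPart (interleave w) = FreeMonoid.ofList w := by
  rw [xPart]
  congr 1
  induction w with
  | nil => rfl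
  | cons i w ih => exact congrArg (List.cons i) ih

theorem yPart_interleave (w : List (Fin s)) : yPart (interleave w) = FreeMonoid.ofList w := by
  rw [yPart]
  congr 1
  induction w with
  | nil => rfl
  | cons i w ih => exact congrArg (List.cons i) ih

theorem xBlocks_interleave (w : List (Fin s)) :
    xBlocks (interleave w) = w.map FreeMonoid.of := by
  rw [xBlocks, blocks_of_isChain (isChain_interleave w)]
  induction w with
  | nil => rfl
  | cons i w ih => exact congrArg (List.cons (FreeMonoid.of i)) ih

theorem yBlocks_interleave (w : List (Fin s)) :
    yBlocks (interleave w) = w.map FreeMonoid.of := by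
  rw [yBlocks, blocks_of_isChain (isChain_interleave w)]
  induction w with
  | nil => rfl
  | cons i w ih => exact congrArg (List.cons (FreeMonoid.of i)) ih

variable (f g : NCSeries R s) (w : FreeMonoid (Fin s))

theorem freeConvM_eq : freeConvM f g w = freeWord f g (interleave w.toList) :=
  convM_functional _ w

theorem booleanConvM_eq : booleanConvM f g w =
    (w.toList.map fun i => f (.of i)).prod * (w.toList.map fun i => g (.of i)).prod := by
  rw [booleanConvM, booleanProd, convM_functional]
  simp [xBlocks_interleave, yBlocks_interleave, Function.comp_def]

theorem monotoneConvM_eq : monotoneConvM f g w =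
    f w * (w.toList.map fun i => g (.of i)).prod := by
  rw [monotoneConvM, monotoneProd, convM_functional]
  simp [xPart_interleave, yBlocks_interleave, Function.comp_def]

theorem antiMonotoneConvM_eq : antiMonotoneConvM f g w =
    (w.toList.map fun i => f (.of i)).prod * g w := by
  rw [antiMonotoneConvM, antiMonotoneProd, convM_functional]
  simp [yPart_interleave, xBlocks_interleave, Function.comp_def]

variable {f g}

theorem blockValue_nil (hf : f 1 = 1) : blockValue f g [] = 1 := hf

theorem freeWord_eq_topMoment_left (hf : f 1 = 1) (n : ℕ)
    (hfn : ∀ v, 0 < v.length → v.length < n → f v = 0) (u : List (Letter s))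
    (hu : u.countP (fun a => a.isLeft) ≤ n) :
    freeWord f g u = topMoment (fun a => a.isLeft) (blockValue f g) n u := by
  have hφ := blockValue_nil (g := g) hf
  refine freeWord_eq_of_centered_eq_zero f g (fun u => u.countP (fun a => a.isLeft) ≤ n)
    (fun u v h hu => h.countP_le.trans hu) _ ?_ (fun u hu hu0 => ?_) u hu
  · rw [topMoment_of_not_special hφ (by simp), hφ]
  · obtain ⟨c, hc⟩ := altBlocks_splitBy (fun a : Letter s => a.isLeft) u
    refine centered_topMoment hφ (fun v hv hv0 hvn => ?_) hc
      (List.splitBy_ne_nil.2 hu0 : blocks u ≠ []) ?_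
    · have := xPart_length_of_isLeft hv
      have := List.length_pos_iff.2 hv0
      rw [blockValue_of_isLeft hv, hfn _ (by omega) (by omega)]
    · rwa [flatten_blocks]

theorem freeWord_eq_topMoment_right (hf : f 1 = 1) (n : ℕ)
    (hgn : ∀ v, 0 < v.length → v.length < n → g v = 0) (u : List (Letter s))
    (hu : u.countP (fun a => !a.isLeft) ≤ n) :
    freeWord f g u = topMoment (fun a => !a.isLeft) (blockValue f g) n u := by
  have hφ := blockValue_nil (g := g) hf
  refine freeWord_eq_of_centered_eq_zero f g (fun u => u.countP (fun a => !a.isLeft) ≤ n)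
    (fun u v h hu => h.countP_le.trans hu) _ ?_ (fun u hu hu0 => ?_) u hu
  · rw [topMoment_of_not_special hφ (by simp), hφ]
  · obtain ⟨c, hc⟩ := altBlocks_splitBy (fun a : Letter s => a.isLeft) u
    refine centered_topMoment hφ (fun v hv hv0 hvn => ?_) hc.not
      (List.splitBy_ne_nil.2 hu0 : blocks u ≠ []) ?_
    · have hv' : ∀ a ∈ v, a.isLeft = false := by simpa using hv
      have := yPart_length_of_not_isLeft hv'
      have := List.length_pos_iff.2 hv0
      rw [blockValue_of_not_isLeft hv' hv0, hgn _ (by omega) (by omega)]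
    · rwa [flatten_blocks]

theorem freeWord_eq_singleMoment (hf : ∀ v, 2 ≤ v.length → f v = 0)
    (hg : ∀ v, 2 ≤ v.length → g v = 0) (u : List (Letter s)) :
    freeWord f g u = singleMoment (fun a => a.isLeft) (blockValue f g) u := by
  refine freeWord_eq_of_centered_eq_zero f g (fun _ => True) (fun _ _ _ _ => trivial) _ ?_
    (fun u _ hu0 => ?_) u trivial
  · simp [singleMoment, ballot]
  · obtain ⟨c, hc⟩ := altBlocks_splitBy (fun a : Letter s => a.isLeft) u
    change AltBlocks _ c (blocks u) at hc
    by_cases hch : u.IsChain fun a b => a.isLeft ≠ b.isLeft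
    · rw [blocks_of_isChain hch]
      exact centered_singleMoment_nil u hu0 hch
    · obtain ⟨v, hv, hv2⟩ : ∃ v ∈ blocks u, 2 ≤ v.length := by
        by_contra! hlt
        have := (hc.isChain_flatten hlt).1
        rw [flatten_blocks] at this
        exact hch this
      refine centered_singleMoment_of_long (fun v ⟨c, hvc⟩ hv2 => ?_) hc hv hv2 []
      cases c with
      | true => rw [blockValue_of_isLeft hvc, hf _ (by rwa [xPart_length_of_isLeft hvc])]
      | false =>
        rw [blockValue_of_not_isLeft hvc (by rintro rfl; simp at hv2),
          hg _ (by rwa [yPart_length_of_not_isLeft hvc])]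

/-- If `f` vanishes in the degrees `1, …, |w| - 1`, only the monotone convolution contributes. -/
theorem freeWord_interleave_of_left (hf : f 1 = 1) (hw : w ≠ 1)
    (hfn : ∀ v, 0 < v.length → v.length < w.length → f v = 0) :
    freeWord f g (interleave w.toList) = f w * (w.toList.map fun i => g (.of i)).prod := by
  have hx : (interleave w.toList).countP (fun a => a.isLeft) = w.length := by
    rw [← xPart_length, xPart_interleave, FreeMonoid.ofList_toList]
  have hφ := blockValue_nil (g := g) hf
  rw [freeWord_eq_topMoment_left hf _ hfn _ hx.le, topMoment, if_pos (Or.inr hx)]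
  have key : ∀ (i : Fin s) (w : List (Fin s)),
      gapProd (fun a => a.isLeft) (blockValue f g) [] [Sum.inr i] (interleave w) =
        ((i :: w).map fun i => g (.of i)).prod := by
    intro i w
    induction w generalizing i with
    | nil => simp [interleave, gapProd, blockValue_inr]
    | cons j w ih =>
      have : interleave (j :: w) = Sum.inl j :: Sum.inr j :: interleave w := rfl
      rw [this, List.map_cons, List.prod_cons, ← ih j]
      simp [gapProd, blockValue_inr]
  congr 1
  · rw [blockValue_of_isLeft (by simp)]
    rw [xPart_filter, xPart_interleave, FreeMonoid.ofList_toList]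
  · cases h : w.toList with
    | nil => exact absurd h hw
    | cons i w =>
      have : interleave (i :: w) = Sum.inl i :: Sum.inr i :: interleave w := rfl
      rw [this, ← key]
      simp [gapProd, outerGapProd]

/-- If `g` vanishes in the degrees `1, …, |w| - 1`, only the anti-monotone convolution
contributes. -/
theorem freeWord_interleave_of_right (hf : f 1 = 1) (hw : w ≠ 1)
    (hgn : ∀ v, 0 < v.length → v.length < w.length → g v = 0) :
    freeWord f g (interleave w.toList) = (w.toList.map fun i => f (.of i)).prod * g w := by
  have hx : (interleave w.toList).countP (fun a => !a.isLeft) = w.length := by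
    rw [← yPart_length, yPart_interleave, FreeMonoid.ofList_toList]
  have hφ := blockValue_nil (g := g) hf
  rw [freeWord_eq_topMoment_right hf _ hgn _ hx.le, topMoment, if_pos (Or.inr hx), mul_comm]
  have key : ∀ (i : Fin s) (w : List (Fin s)),
      gapProd (fun a => !a.isLeft) (blockValue f g) [Sum.inl i] [] (interleave w) =
        ((i :: w).map fun i => f (.of i)).prod := by
    intro i w
    induction w with
    | nil => simp [interleave, gapProd, blockValue_inl]
    | cons j w ih =>
      have : interleave (j :: w) = Sum.inl j :: Sum.inr j :: interleave w := rfl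
      rw [this, gapProd, if_neg (by simp), gapProd, if_pos (by simp), ih]
      simp [blockValue_inl, mul_left_comm]
  congr 1
  · cases h : w.toList with
    | nil => exact absurd h hw
    | cons i w =>
      have : interleave (i :: w) = Sum.inl i :: Sum.inr i :: interleave w := rfl
      rw [this, ← key]
      simp [outerGapProd]
  · rw [blockValue_of_not_isLeft (by simp)]
    · rw [yPart_filter, yPart_interleave, FreeMonoid.ofList_toList]
    · intro h
      rw [List.countP_eq_length_filter, h] at hx
      exact hw (FreeMonoid.length_eq_zero.1 hx.symm)

/-- If `f` and `g` vanish in the degrees above one, only the boolean convolution contributes, with a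
signed Catalan number as its coefficient. -/
theorem freeWord_interleave_of_single (hw : w ≠ 1) (hf : ∀ v, 2 ≤ v.length → f v = 0)
    (hg : ∀ v, 2 ≤ v.length → g v = 0) :
    freeWord f g (interleave w.toList) = (-1) ^ (w.length - 1) * (catalan (w.length - 1) : R) *
      ((w.toList.map fun i => f (.of i)).prod * (w.toList.map fun i => g (.of i)).prod) := by
  have hlen : (interleave w.toList).length = 2 * w.length := by
    rw [interleave, List.length_flatMap]
    simp [mul_comm, FreeMonoid.length]
  have hpos : 0 < w.length := Nat.pos_of_ne_zero fun h => hw (FreeMonoid.length_eq_zero.1 h)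
  rw [freeWord_eq_singleMoment hf hg, singleMoment, if_pos (isChain_interleave _), hlen,
    show 2 * w.length - 1 = 2 * (w.length - 1) + 1 by omega, ballot_catalan]
  push_cast
  congr 1
  induction w.toList with
  | nil => simp [interleave]
  | cons i w ih =>
    have : interleave (i :: w) = Sum.inl i :: Sum.inr i :: interleave w := rfl
    rw [this]
    simp only [List.map_cons, List.prod_cons, ih, blockValue_inl, blockValue_inr]
    ring

end Interleave

/-! ### The generic convolution and its remainder -/

section Universal

variable {R : Type*} [CommRing R] {s : ℕ}

/-- The contribution of the monotone, the anti-monotone and the boolean convolution. -/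
def leadingTerms (f g : NCSeries R s) (w : FreeMonoid (Fin s)) : R :=
  f w * (w.toList.map fun i => g (.of i)).prod + (w.toList.map fun i => f (.of i)).prod * g w +
    (-1) ^ (w.length - 1) * (catalan (w.length - 1) : R) *
      ((w.toList.map fun i => f (.of i)).prod * (w.toList.map fun i => g (.of i)).prod)

theorem leadingTerms_map {S : Type*} [CommRing S] (φ : R →+* S) (f g : NCSeries R s)
    (w : FreeMonoid (Fin s)) :
    leadingTerms (fun v => φ (f v)) (fun v => φ (g v)) w = φ (leadingTerms f g w) := by
  simp [leadingTerms, map_list_prod, Function.comp_def]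

theorem prod_map_eq_zero {f : NCSeries R s} {w : FreeMonoid (Fin s)} (hw : w ≠ 1)
    (hf : ∀ i, f (.of i) = 0) : (w.toList.map fun i => f (.of i)).prod = 0 := by
  obtain ⟨i, v, h⟩ := List.exists_cons_of_ne_nil (show w.toList ≠ [] from hw)
  rw [h, List.map_cons, List.prod_cons, hf, zero_mul]

variable (s) in
/-- The generic power series with constant term `1` whose other coefficients are the variables
`X_u`. -/
noncomputable def genericX : NCSeries (CoeffPoly s) s :=
  fun u => if u.length = 0 then 1 else MvPolynomial.X (Sum.inl u)

variable (s) in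
/-- The generic power series with constant term `1` whose other coefficients are the variables
`Y_v`. -/
noncomputable def genericY : NCSeries (CoeffPoly s) s :=
  fun u => if u.length = 0 then 1 else MvPolynomial.X (Sum.inr u)

/-- The part of the generic multiplicative free convolution that is not accounted for by the
monotone, the anti-monotone and the boolean convolution. -/
noncomputable def remainder (w : FreeMonoid (Fin s)) : CoeffPoly s :=
  freeWord (genericX s) (genericY s) (interleave w.toList) -
    leadingTerms (genericX s) (genericY s) w

theorem remainder_map {S : Type*} [CommRing S] (φ : CoeffPoly s →+* S) (w : FreeMonoid (Fin s)) :
    φ (remainder w) =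
      freeWord (fun v => φ (genericX s v)) (fun v => φ (genericY s v)) (interleave w.toList) -
        leadingTerms (fun v => φ (genericX s v)) (fun v => φ (genericY s v)) w := by
  rw [remainder, map_sub, freeWord_map, leadingTerms_map]

theorem aeval_genericX {f : NCSeries R s} (g : NCSeries R s) (hf : f 1 = 1) :
    (fun v => MvPolynomial.aeval (R := ℤ) (Sum.elim f g) (genericX s v)) = f := by
  funext v
  rw [genericX]
  split_ifs with h
  · rw [FreeMonoid.length_eq_zero.1 h, map_one, hf]
  · simp

theorem aeval_genericY (f : NCSeries R s) {g : NCSeries R s} (hg : g 1 = 1) :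
    (fun v => MvPolynomial.aeval (R := ℤ) (Sum.elim f g) (genericY s v)) = g := by
  funext v
  rw [genericY]
  split_ifs with h
  · rw [FreeMonoid.length_eq_zero.1 h, map_one, hg]
  · simp

theorem freeConvM_eq_add_remainder (f g : NCSeries R s) (hf : f 1 = 1) (hg : g 1 = 1)
    (w : FreeMonoid (Fin s)) :
    freeConvM f g w = leadingTerms f g w + MvPolynomial.aeval (Sum.elim f g) (remainder w) := by
  have h := remainder_map (MvPolynomial.aeval (R := ℤ) (Sum.elim f g) : CoeffPoly s →+* R) w
  simp only [RingHom.coe_coe] at h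
  rw [h, aeval_genericX g hf, aeval_genericY f hg, freeConvM_eq]
  ring

end Universal

/-! ### Homogeneity of the remainder -/

section Homogeneous

variable {s : ℕ} {σ : Type*}

theorem countP_concatOn {α : Type*} (p : α → Bool) (L : List (List α))
    (I : Finset (Fin L.length)) :
    (concatOn L I).countP p = ∑ i ∈ I, (L.get i).countP p := by
  have h : ((List.finRange L.length).filter (fun i => i ∈ I)).toFinset = I := by
    ext i; simp
  have hn : ((List.finRange L.length).filter (fun i => i ∈ I)).Nodup :=
    (List.nodup_finRange _).filter _
  conv_rhs => rw [← h]
  rw [concatOn, List.countP_flatMap, List.sum_toFinset _ hn]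
  rfl

/-- If the coefficients of `f` and `g` at `v` are homogeneous of degrees `a |v|` and `b |v|`, the
free product at `u` is homogeneous, an `x`-letter counting `a` and a `y`-letter counting `b`. -/
theorem isWeightedHomogeneous_freeWord {wt : σ → ℕ} {a b : ℕ}
    {f g : NCSeries (MvPolynomial σ ℤ) s}
    (hf : ∀ v, (f v).IsWeightedHomogeneous wt (a * v.length))
    (hg : ∀ v, (g v).IsWeightedHomogeneous wt (b * v.length)) (u : List (Letter s)) :
    (freeWord f g u).IsWeightedHomogeneous wt
      (a * u.countP (fun z => z.isLeft) + b * u.countP (fun z => !z.isLeft)) := by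
  have hblock : ∀ c L, AltBlocks (fun z : Letter s => z.isLeft) c L → ∀ v ∈ L,
      (blockValue f g v).IsWeightedHomogeneous wt
        (a * v.countP (fun z => z.isLeft) + b * v.countP (fun z => !z.isLeft)) := by
    intro c L h
    induction h with
    | nil => simp
    | @cons c v L hv0 hv _ ih =>
      intro v' hv'
      rcases List.mem_cons.1 hv' with rfl | hv'
      · rw [← xPart_length, ← yPart_length]
        cases c with
        | true =>
          rw [blockValue_of_isLeft hv]
          have : (yPart v').length = 0 := by
            rw [yPart_length, List.countP_eq_zero]
            simpa using hv
          simpa [this] using hf (xPart v')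
        | false =>
          rw [blockValue_of_not_isLeft hv hv0]
          have : (xPart v').length = 0 := by
            rw [xPart_length, List.countP_eq_zero]
            simpa using hv
          simpa [this] using hg (yPart v')
      · exact ih v' hv'
  induction hn : u.length using Nat.strong_induction_on generalizing u with
  | _ n ih =>
    by_cases h0 : u = []
    · rw [h0, freeWord_nil]
      exact MvPolynomial.isWeightedHomogeneous_one _ _
    rw [freeWord_of_ne_nil _ _ h0]
    refine MvPolynomial.IsWeightedHomogeneous.sum _ _ _ fun I hI => ?_
    have h1 := ih _ (hn ▸ length_concatOn_blocks_lt u I (Finset.mem_ssubsets.1 hI)) _ rfl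
    obtain ⟨c, hc⟩ := altBlocks_splitBy (fun a : Letter s => a.isLeft) u
    have h2 := MvPolynomial.IsWeightedHomogeneous.prod Iᶜ
      (fun i => blockValue f g ((blocks u).get i)) _
      (fun i _ => hblock c _ hc ((blocks u).get i) (List.get_mem _ i))
    have h3 : ((-1 : MvPolynomial σ ℤ) ^ ((blocks u).length - I.card + 1)).IsWeightedHomogeneous
        wt 0 := by
      have := MvPolynomial.isWeightedHomogeneous_C (R := ℤ) wt
        ((-1) ^ ((blocks u).length - I.card + 1))
      simpa using this
    have h4 := (h3.mul h1).mul h2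
    rw [countP_concatOn, countP_concatOn, Finset.sum_add_distrib, ← Finset.mul_sum,
      ← Finset.mul_sum] at h4
    have e1 := Finset.sum_add_sum_compl I fun i => ((blocks u).get i).countP fun z => z.isLeft
    have e2 := Finset.sum_add_sum_compl I fun i => ((blocks u).get i).countP fun z => !z.isLeft
    rw [← countP_concatOn _ _ Finset.univ, concatOn_univ, flatten_blocks] at e1 e2
    rw [← e1, ← e2]
    convert h4 using 1
    ring

theorem isWeightedHomogeneous_prod_map {wt : σ → ℕ} {a : ℕ} {f : NCSeries (MvPolynomial σ ℤ) s}
    (hf : ∀ v, (f v).IsWeightedHomogeneous wt (a * v.length)) (w : List (Fin s)) :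
    ((w.map fun i => f (.of i)).prod).IsWeightedHomogeneous wt (a * w.length) := by
  induction w with
  | nil => exact MvPolynomial.isWeightedHomogeneous_one _ _
  | cons i w ih =>
    rw [List.map_cons, List.prod_cons, List.length_cons, mul_add, add_comm]
    exact (hf _).mul ih

theorem isWeightedHomogeneous_leadingTerms {wt : σ → ℕ} {a b : ℕ}
    {f g : NCSeries (MvPolynomial σ ℤ) s}
    (hf : ∀ v, (f v).IsWeightedHomogeneous wt (a * v.length))
    (hg : ∀ v, (g v).IsWeightedHomogeneous wt (b * v.length)) (w : FreeMonoid (Fin s)) :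
    (leadingTerms f g w).IsWeightedHomogeneous wt (a * w.length + b * w.length) := by
  have hf' : (w.toList.map fun i => f (.of i)).prod.IsWeightedHomogeneous wt (a * w.length) :=
    isWeightedHomogeneous_prod_map hf w.toList
  have hg' : (w.toList.map fun i => g (.of i)).prod.IsWeightedHomogeneous wt (b * w.length) :=
    isWeightedHomogeneous_prod_map hg w.toList
  refine (((hf w).mul hg').add (hf'.mul (hg w))).add ?_
  have h3 := MvPolynomial.isWeightedHomogeneous_C (R := ℤ) wt
    ((-1) ^ (w.length - 1) * (catalan (w.length - 1) : ℤ))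
  have h4 := h3.mul (hf'.mul hg')
  rw [zero_add] at h4
  simpa using h4

theorem isWeightedHomogeneous_remainder {wt : FreeMonoid (Fin s) ⊕ FreeMonoid (Fin s) → ℕ}
    {a b : ℕ} (ha : ∀ v, wt (Sum.inl v) = a * v.length) (hb : ∀ v, wt (Sum.inr v) = b * v.length)
    (w : FreeMonoid (Fin s)) :
    (remainder w).IsWeightedHomogeneous wt (a * w.length + b * w.length) := by
  have hf : ∀ v, (genericX s v).IsWeightedHomogeneous wt (a * v.length) := by
    intro v
    rw [genericX]
    split_ifs with h
    · rw [h]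
      exact MvPolynomial.isWeightedHomogeneous_one _ _
    · rw [← ha]
      exact MvPolynomial.isWeightedHomogeneous_X _ _ _
  have hg : ∀ v, (genericY s v).IsWeightedHomogeneous wt (b * v.length) := by
    intro v
    rw [genericY]
    split_ifs with h
    · rw [h]
      exact MvPolynomial.isWeightedHomogeneous_one _ _
    · rw [← hb]
      exact MvPolynomial.isWeightedHomogeneous_X _ _ _
  have h := isWeightedHomogeneous_freeWord hf hg (interleave w.toList)
  rw [← xPart_length, ← yPart_length, xPart_interleave, yPart_interleave] at h
  exact h.sub (isWeightedHomogeneous_leadingTerms hf hg w)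

end Homogeneous

/-! ### The variables that occur in the remainder -/

section Restriction

open MvPolynomial

open scoped Classical in
/-- The endomorphism of the polynomial ring that sets all variables outside of `S` to zero. -/
noncomputable def restrictVars {σ : Type*} (S : Set σ) :
    MvPolynomial σ ℤ →ₐ[ℤ] MvPolynomial σ ℤ :=
  aeval fun z => if z ∈ S then X z else 0

theorem coeff_restrictVars {σ : Type*} (S : Set σ) (p : MvPolynomial σ ℤ) {m : σ →₀ ℕ}
    (hm : ∀ z ∈ m.support, z ∈ S) : coeff m (restrictVars S p) = coeff m p := by
  classical
  induction p using MvPolynomial.induction_on' with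
  | add p q hp hq => rw [map_add, coeff_add, coeff_add, hp, hq]
  | monomial d a =>
    rw [restrictVars, aeval_monomial]
    by_cases hd : ∀ z ∈ d.support, z ∈ S
    · rw [monomial_eq]
      congr 2
      exact Finset.prod_congr rfl fun z hz => by simp only [if_pos (hd z hz)]
    · have hne : d ≠ m := by
        rintro rfl
        exact hd hm
      push Not at hd
      obtain ⟨z, hz, hzS⟩ := hd
      rw [Finsupp.prod, Finset.prod_eq_zero hz, mul_zero, coeff_zero, coeff_monomial, if_neg hne]
      rw [if_neg hzS, zero_pow (Finsupp.mem_support_iff.1 hz)]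

theorem exists_notMem_of_restrictVars_eq_zero {σ : Type*} {S : Set σ} {p : MvPolynomial σ ℤ}
    (hp : restrictVars S p = 0) {m : σ →₀ ℕ} (hm : m ∈ p.support) : ∃ z ∈ m.support, z ∉ S := by
  by_contra! h
  have := coeff_restrictVars S p h
  rw [hp, coeff_zero] at this
  exact mem_support_iff.1 hm this.symm

variable {s : ℕ} (S : Set (FreeMonoid (Fin s) ⊕ FreeMonoid (Fin s)))

theorem restrictVars_genericX_one : restrictVars S (genericX s 1) = 1 := by
  rw [genericX, if_pos FreeMonoid.length_one, map_one]

theorem restrictVars_genericX_eq_zero {v : FreeMonoid (Fin s)} (hv : 0 < v.length)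
    (h : Sum.inl v ∉ S) : restrictVars S (genericX s v) = 0 := by
  rw [genericX, if_neg hv.ne', restrictVars, aeval_X, if_neg h]

theorem restrictVars_genericY_eq_zero {v : FreeMonoid (Fin s)} (hv : 0 < v.length)
    (h : Sum.inr v ∉ S) : restrictVars S (genericY s v) = 0 := by
  rw [genericY, if_neg hv.ne', restrictVars, aeval_X, if_neg h]

theorem restrictVars_remainder (w : FreeMonoid (Fin s)) :
    restrictVars S (remainder w) =
      freeWord (fun v => restrictVars S (genericX s v)) (fun v => restrictVars S (genericY s v))
        (interleave w.toList) -
      leadingTerms (fun v => restrictVars S (genericX s v))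
        (fun v => restrictVars S (genericY s v)) w :=
  remainder_map (restrictVars S : CoeffPoly s →+* CoeffPoly s) w

variable {w : FreeMonoid (Fin s)}

theorem ne_one_of_two_le_length (hw : 2 ≤ w.length) : w ≠ 1 := by
  rintro rfl
  simp at hw

/-- Obtained by setting all variables indexed by words of length at least two to zero. -/
theorem exists_two_le_varLength (hw : 2 ≤ w.length) {m}
    (hm : m ∈ (remainder w).support) :
    ∃ z ∈ m.support, 2 ≤ varLength z := by
  have hw1 := ne_one_of_two_le_length hw
  have h : restrictVars {z | varLength z < 2} (remainder w) = 0 := by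
    have hX : ∀ v : FreeMonoid (Fin s), 2 ≤ v.length →
        restrictVars {z | varLength z < 2} (genericX s v) = 0 := fun v hv =>
      restrictVars_genericX_eq_zero _ (by omega) (not_lt.2 hv)
    have hY : ∀ v : FreeMonoid (Fin s), 2 ≤ v.length →
        restrictVars {z | varLength z < 2} (genericY s v) = 0 := fun v hv =>
      restrictVars_genericY_eq_zero _ (by omega) (not_lt.2 hv)
    rw [restrictVars_remainder, freeWord_interleave_of_single _ hw1 hX hY, leadingTerms, hX w hw,
      hY w hw]
    ring
  obtain ⟨z, hz, hzS⟩ := exists_notMem_of_restrictVars_eq_zero h hm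
  exact ⟨z, hz, not_lt.1 hzS⟩

/-- Obtained by setting all `X_u` with `|u| < |w|` to zero. -/
theorem exists_inl_length_lt (hw : 2 ≤ w.length) {m}
    (hm : m ∈ (remainder w).support) :
    ∃ v, Sum.inl v ∈ m.support ∧ v.length < w.length := by
  have hw1 := ne_one_of_two_le_length hw
  let S : Set (FreeMonoid (Fin s) ⊕ FreeMonoid (Fin s)) :=
    {z | ∀ v, z = Sum.inl v → w.length ≤ v.length}
  have h : restrictVars S (remainder w) = 0 := by
    have hX : ∀ v : FreeMonoid (Fin s), 0 < v.length → v.length < w.length →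
        restrictVars S (genericX s v) = 0 := fun v hv hvw =>
      restrictVars_genericX_eq_zero _ hv fun h => (h v rfl).not_gt hvw
    rw [restrictVars_remainder,
      freeWord_interleave_of_left _ (restrictVars_genericX_one S) hw1 hX, leadingTerms,
      prod_map_eq_zero (f := fun v => restrictVars S (genericX s v)) hw1 fun i =>
        hX _ (by simp) (by rw [FreeMonoid.length_of]; omega)]
    ring
  obtain ⟨z, hz, hzS⟩ := exists_notMem_of_restrictVars_eq_zero h hm
  simp only [S, Set.mem_ofPred_eq, not_forall, not_le] at hzS
  obtain ⟨v, rfl, hv⟩ := hzS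
  exact ⟨v, hz, hv⟩

/-- Obtained by setting all `Y_v` with `|v| < |w|` to zero. -/
theorem exists_inr_length_lt (hw : 2 ≤ w.length) {m}
    (hm : m ∈ (remainder w).support) :
    ∃ v, Sum.inr v ∈ m.support ∧ v.length < w.length := by
  have hw1 := ne_one_of_two_le_length hw
  let S : Set (FreeMonoid (Fin s) ⊕ FreeMonoid (Fin s)) :=
    {z | ∀ v, z = Sum.inr v → w.length ≤ v.length}
  have h : restrictVars S (remainder w) = 0 := by
    have hY : ∀ v : FreeMonoid (Fin s), 0 < v.length → v.length < w.length →
        restrictVars S (genericY s v) = 0 := fun v hv hvw =>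
      restrictVars_genericY_eq_zero _ hv fun h => (h v rfl).not_gt hvw
    rw [restrictVars_remainder,
      freeWord_interleave_of_right _ (restrictVars_genericX_one S) hw1 hY, leadingTerms,
      prod_map_eq_zero (f := fun v => restrictVars S (genericY s v)) hw1 fun i =>
        hY _ (by simp) (by rw [FreeMonoid.length_of]; omega)]
    ring
  obtain ⟨z, hz, hzS⟩ := exists_notMem_of_restrictVars_eq_zero h hm
  simp only [S, Set.mem_ofPred_eq, not_forall, not_le] at hzS
  obtain ⟨v, rfl, hv⟩ := hzS
  exact ⟨v, hz, hv⟩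

/-- The generic series have their coefficients in the subalgebra generated by the variables indexed
by non-empty words. -/
theorem one_le_varLength {m} (hm : m ∈ (remainder w).support) {z} (hz : z ∈ m.support) :
    1 ≤ varLength z := by
  let A : Subalgebra ℤ (CoeffPoly s) := supported ℤ {z | 1 ≤ varLength z}
  have hX : ∀ v, genericX s v ∈ A := by
    intro v
    rw [genericX]
    split_ifs with h
    · exact one_mem A
    · exact Algebra.subset_adjoin (Set.mem_image_of_mem X (Nat.pos_of_ne_zero h))
  have hY : ∀ v, genericY s v ∈ A := by
    intro v
    rw [genericY]
    split_ifs with h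
    · exact one_mem A
    · exact Algebra.subset_adjoin (Set.mem_image_of_mem X (Nat.pos_of_ne_zero h))
  have h1 := freeWord_map (A.val : A →+* CoeffPoly s) (fun v => ⟨_, hX v⟩) (fun v => ⟨_, hY v⟩)
    (interleave w.toList)
  have h2 := leadingTerms_map (A.val : A →+* CoeffPoly s) (fun v => ⟨_, hX v⟩)
    (fun v => ⟨_, hY v⟩) w
  have h : remainder w ∈ A := by
    refine sub_mem ?_ ?_
    · exact h1 ▸ Subtype.property _
    · exact h2 ▸ Subtype.property _
  exact mem_supported.1 h (mem_vars_iff_mem_support z |>.2 ⟨m, hm, hz⟩)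

theorem add_le_weight {σ : Type*} (wt : σ → ℕ) {m : σ →₀ ℕ} {y z : σ} (hy : y ∈ m.support)
    (hz : z ∈ m.support) (hyz : y ≠ z) : wt y + wt z ≤ Finsupp.weight wt m := by
  classical
  rw [Finsupp.weight_apply, Finsupp.sum, ← Finset.sum_pair hyz]
  refine (Finset.sum_le_sum fun i hi => ?_).trans
    (Finset.sum_le_sum_of_subset (f := fun i => m i • wt i)
      (Finset.insert_subset hy (Finset.singleton_subset_iff.2 hz)))
  have him : i ∈ m.support := by
    rcases Finset.mem_insert.1 hi with rfl | hi
    · exact hy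
    · rwa [Finset.mem_singleton.1 hi]
  exact Nat.le_mul_of_pos_left _ (Nat.pos_of_ne_zero (Finsupp.mem_support_iff.1 him))

theorem isMixed_remainder (hw : 2 ≤ w.length) : IsMixed w.length (remainder w) := by
  have hl := isWeightedHomogeneous_remainder (wt := Sum.elim FreeMonoid.length fun _ => 0)
    (a := 1) (b := 0) (by simp) (by simp) w
  have hr := isWeightedHomogeneous_remainder (wt := Sum.elim (fun _ => 0) FreeMonoid.length)
    (a := 0) (b := 1) (by simp) (by simp) w
  simp only [one_mul, zero_mul, add_zero, zero_add] at hl hr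
  have hlt : ∀ m ∈ (remainder w).support, ∀ z ∈ m.support, varLength z < w.length := by
    intro m hm z hz
    have hpos := one_le_varLength hm hz
    -- An `X_v` with `1 ≤ |v| < |w|` occurs in `m`, so that any other `X_u` in `m` has `|u| < |w|` by
    -- homogeneity; similarly for the `Y`-variables.
    rcases z with u | u
    · obtain ⟨v, hv, hvw⟩ := exists_inl_length_lt hw hm
      have hvpos := one_le_varLength hm hv
      by_cases huv : u = v
      · exact huv ▸ hvw
      · have := add_le_weight (Sum.elim FreeMonoid.length fun _ => 0) hz hv (by simpa using huv)
        rw [hl (mem_support_iff.1 hm)] at this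
        simp only [Sum.elim_inl, varLength] at *
        omega
    · obtain ⟨v, hv, hvw⟩ := exists_inr_length_lt hw hm
      have hvpos := one_le_varLength hm hv
      by_cases huv : u = v
      · exact huv ▸ hvw
      · have := add_le_weight (Sum.elim (fun _ => 0) FreeMonoid.length) hz hv (by simpa using huv)
        rw [hr (mem_support_iff.1 hm)] at this
        simp only [Sum.elim_inr, varLength] at *
        omega
  refine ⟨hl, hr, fun m hm z hz => ⟨one_le_varLength hm hz, hlt m hm z hz⟩, fun m hm => ?_⟩
  obtain ⟨z, hz, hz2⟩ := exists_two_le_varLength hw hm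
  exact ⟨z, hz, hz2, hlt m hm z hz⟩

end Restriction

end MomentConvolution

theorem mainTheorem2 (s : ℕ) (w : FreeMonoid (Fin s)) (hw : 2 ≤ w.length) :
    ∃ P : CoeffPoly s, IsMixed w.length P ∧
      ∀ (k : Type*) [Field k] [CharZero k] (R : Type*) [CommRing R] [Algebra k R]
        (f g : NCSeries R s), f 1 = 1 → g 1 = 1 →
        freeConvM f g w =
          monotoneConvM f g w + antiMonotoneConvM f g w
            + (-1) ^ (w.length - 1) * (catalan (w.length - 1) : R) * booleanConvM f g w
            + MvPolynomial.aeval (Sum.elim f g) P := by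
  refine ⟨remainder w, isMixed_remainder hw, ?_⟩
  intro k _ _ R _ _ f g hf hg
  rw [freeConvM_eq_add_remainder f g hf hg, leadingTerms, monotoneConvM_eq, antiMonotoneConvM_eq,
    booleanConvM_eq]
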